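/- Let $\mathbb{T}^2=(\mathbb{R}/\mathbb{Z})^2$ with $\|x\|_{\mathbb{T}^2}=\min_{j\in\mathbb{Z}^2}\|x+j\|_\infty$, let $N\ge 1$ be an integer and $c_{\min}>0$. For $i=1,2$ let $\mu_i=\sum_{t\in Y_i}c^{(i)}_t\delta_t$ be a complex measure on $\mathbb{T}^2$ with finite node set $Y_i\subset\mathbb{T}^2$ and weights $c^{(i)}_t\in\mathbb{C}$ such that $|c^{(i)}_t|\ge c_{\min}$ for all $t\in Y_i$, $\sum_{t\in Y_i}c^{(i)}_t=1$, and $\|s-t\|_{\mathbb{T}^2}\ge \frac{2\sqrt2}{N}$ for all distinct $s,t\in Y_i$. For $k\in\mathbb{Z}^2$ let $\hat\mu_i(k)=\int e^{-2\pi i k\cdot x}\,d\mu_i(x)=\sum_{t\in Y_i}c^{(i)}_te^{-2\pi i k\cdot t}$. Assume that $$\sum_{k\in\mathbb{Z}^2,\ \|k\|_2\le N}|\hat\mu_1(k)-\hat\mu_2(k)|^2<\frac34 N^2c_{\min}^2 .$$ Then for every $t\in Y_1$ there is exactly one $\eta(t)\in Y_2$ with $\|t-\eta(t)\|_{\mathbb{T}^2}\le\frac{1}{\sqrt2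 N}$, and for every $t'\in Y_2$ there is exactly one $t\in Y_1$ with $\|t-t'\|_{\mathbb{T}^2}\le\frac{1}{\sqrt2 N}$. Moreover, $$\sum_{k\in\mathbb{Z}^2,\ \|k\|_2\le N}|\hat\mu_1(k)-\hat\mu_2(k)|^2\ \ge\ \frac54N^4c_{\min}^2\sum_{t\in Y_1}\|t-\eta(t)\|_{\mathbb{T}^2}^2+\frac1{16}N^2\sum_{t\in Y_1}\bigl|c^{(1)}_t-c^{(2)}_{\eta(t)}\bigr|^2 .$$ -/

import Mathlib

open MeasureTheory

/-- The complex measure `∑_{t ∈ Y} c_t δ_t` on the torus `(ℝ/ℤ)^d`. -/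
noncomputable def atomicMeasure {d : ℕ} (Y : Finset (UnitAddTorus (Fin d)))
    (c : UnitAddTorus (Fin d) → ℂ) : ComplexMeasure (UnitAddTorus (Fin d)) :=
  ∑ t ∈ Y, VectorMeasure.dirac t (c t)

/-- The set of normalised atomic complex measures on `(ℝ/ℤ)^d` whose weights have modulus at least
`cmin` and whose nodes are `q`-separated. The norm on `UnitAddTorus (Fin d)` is
`‖x‖ = min_{j ∈ ℤ^d} ‖x + j‖_∞`. A one-point node set is `q`-separated for every `q`. -/
def separatedMeasures (d : ℕ) (cmin q : ℝ) : Set (ComplexMeasure (UnitAddTorus (Fin d))) :=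
  {μ | ∃ (Y : Finset (UnitAddTorus (Fin d))) (c : UnitAddTorus (Fin d) → ℂ),
    (∀ t ∈ Y, cmin ≤ ‖c t‖) ∧ ∑ t ∈ Y, c t = 1 ∧
    (Y : Set (UnitAddTorus (Fin d))).Pairwise (fun s t => q ≤ ‖s - t‖) ∧
    μ = atomicMeasure Y c}

/-- The weight `c_t = μ({t})` of a complex measure at the point `t`. -/
noncomputable def weight {d : ℕ} (μ : ComplexMeasure (UnitAddTorus (Fin d)))
    (t : UnitAddTorus (Fin d)) : ℂ :=
  μ {t}

/-- The node set of an atomic measure: the points of nonzero weight. -/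
def nodeSet {d : ℕ} (μ : ComplexMeasure (UnitAddTorus (Fin d))) : Set (UnitAddTorus (Fin d)) :=
  {t | weight μ t ≠ 0}

/-- The trigonometric moment `∫ e^{-2πi k·x} dμ(x)`. -/
noncomputable def moment {d : ℕ} (μ : ComplexMeasure (UnitAddTorus (Fin d)))
    (k : Fin d → ℤ) : ℂ :=
  ∫ᵛ x, UnitAddTorus.mFourier (-k) x ∂[ContinuousLinearMap.mul ℝ ℂ; μ]

/-- The frequencies `k ∈ ℤ^d` with Euclidean norm at most `N`. -/
noncomputable def lowPass (d N : ℕ) : Finset (Fin d → ℤ) :=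
  (Fintype.piFinset fun _ => Finset.Icc (-(N : ℤ)) N).filter fun k => ∑ i, k i ^ 2 ≤ (N : ℤ) ^ 2

theorem mem_lowPass {d N : ℕ} {k : Fin d → ℤ} :
    k ∈ lowPass d N ↔ ‖WithLp.toLp 2 (fun i => (k i : ℝ))‖ ≤ N := by
  have key : ‖WithLp.toLp 2 (fun i => (k i : ℝ))‖ ≤ N ↔ ∑ i, k i ^ 2 ≤ (N : ℤ) ^ 2 := by
    rw [EuclideanSpace.norm_eq, Real.sqrt_le_left (by positivity)]
    simp only [Real.norm_eq_abs, sq_abs]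
    exact_mod_cast Iff.rfl
  rw [key, lowPass, Finset.mem_filter, Fintype.mem_piFinset, and_iff_right_iff_imp]
  intro h i
  have h1 : k i ^ 2 ≤ (N : ℤ) ^ 2 :=
    (Finset.single_le_sum (f := fun i => k i ^ 2) (fun j _ => sq_nonneg (k j))
      (Finset.mem_univ i)).trans h
  rw [Finset.mem_Icc]
  exact abs_le.mp (abs_le_of_sq_le_sq h1 (by positivity))

theorem weight_atomicMeasure {d : ℕ} (Y : Finset (UnitAddTorus (Fin d)))
    (c : UnitAddTorus (Fin d) → ℂ) (t : UnitAddTorus (Fin d)) [Decidable (t ∈ Y)] :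
    weight (atomicMeasure Y c) t = if t ∈ Y then c t else 0 := by
  classical
  have h : ∀ s, (VectorMeasure.dirac s (c s) : ComplexMeasure (UnitAddTorus (Fin d))) {t}
      = if t = s then c s else 0 := by
    intro s
    split_ifs with hst
    · exact VectorMeasure.dirac_apply_of_mem (MeasurableSet.singleton t) hst.symm
    · exact VectorMeasure.dirac_apply_of_notMem fun h => hst h.symm
  have h2 : weight (atomicMeasure Y c) t
      = ∑ s ∈ Y, (VectorMeasure.dirac s (c s) : ComplexMeasure (UnitAddTorus (Fin d))) {t} := by
    simp only [weight, atomicMeasure]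
    exact map_sum (⟨⟨fun μ : ComplexMeasure (UnitAddTorus (Fin d)) => μ {t}, rfl⟩,
      fun _ _ => rfl⟩ : ComplexMeasure (UnitAddTorus (Fin d)) →+ ℂ) _ _
  rw [h2, Finset.sum_congr rfl fun s _ => h s, Finset.sum_ite_eq]
  split_ifs <;> rfl

theorem moment_atomicMeasure {d : ℕ} (Y : Finset (UnitAddTorus (Fin d)))
    (c : UnitAddTorus (Fin d) → ℂ) (k : Fin d → ℤ) :
    moment (atomicMeasure Y c) k = ∑ t ∈ Y, c t * UnitAddTorus.mFourier (-k) t := by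
  rw [moment, atomicMeasure, VectorMeasure.integral_finsetSum_vectorMeasure]
  · refine Finset.sum_congr rfl fun t _ => ?_
    rw [VectorMeasure.integral_dirac, ContinuousLinearMap.mul_apply', mul_comm]
  · intro t _
    have : IsFiniteMeasure
        (VectorMeasure.dirac t (c t) : ComplexMeasure (UnitAddTorus (Fin d))).variation := by
      have h : ‖c t‖ₑ • Measure.dirac t = ‖c t‖₊ • Measure.dirac t := rfl
      rw [VectorMeasure.variation_dirac, h]
      infer_instance
    exact (BoundedContinuousFunction.mkOfCompact (UnitAddTorus.mFourier (-k))).integrable _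

theorem nodeSet_atomicMeasure {d : ℕ} (Y : Finset (UnitAddTorus (Fin d)))
    (c : UnitAddTorus (Fin d) → ℂ) (hc : ∀ t ∈ Y, c t ≠ 0) :
    nodeSet (atomicMeasure Y c) = (Y : Set (UnitAddTorus (Fin d))) := by
  classical
  ext t
  by_cases ht : t ∈ Y <;> simp [nodeSet, weight_atomicMeasure, ht, hc]

/-! Put `L = √2 / N`, so the nodes are `2 * L`-separated and the matching radius is `L / 2`. The
estimate rests on a kernel `Ψ` on the torus that vanishes for `‖x‖ ≥ L` and for which `N ^ 2` times
its Fourier coefficients is at most the indicator of `‖k‖₂ ≤ N`. Expanding `|μ̂₁ - μ̂₂|²` then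
bounds the moment sum below by `N ^ 2` times the quadratic form of `Ψ` at `μ₁ - μ₂`
(`kernelForm_le_sum_lowPass`). By the support condition, only the diagonal, with `Ψ 0 = 3 / 4`, and
nearby pairs of one node from each measure contribute.

To build `Ψ`, let `f` be the autocorrelation of the Hann window. Its transform is nonnegative, and
`4 f + f'' / π²` has the transform of `f` times `(4π² - ω²) / π²`. Symmetrizing `(4 f + f'' / π²) ⊗
f` and sampling at `ω = 2πLk` gives nonnegative factors times `2 - L² |k|² = 2 (1 - |k|² / N²)`,
which changes sign exactly at `|k| = N`.

If a node had no partner within `L / 2`, it would contribute at least `3 / 4 * cmin ^ 2` to the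
form, either alone or with its only partner within `L` (`exists_near_of_pairForm_lt`). Once all
nodes are matched, a pair with weights `a`, `b` at difference `x` contributes `(3/4 - Ψ x) (|a|² +
|b|²) + Ψ x |a - b|²`. The bounds `3/4 - Ψ x ≥ 5/4 (‖x‖ / L)²` and `Ψ x ≥ 1/16` give the two sums
(`matched_sum_le_pairForm`).

The kernel fits into one period only if `L ≤ 1 / 2`, that is `N ≥ 3`. For `N ≤ 2` each measure is a
single unit mass, and two frequencies suffice. -/

/-! ### Calculus of the one-dimensional profiles -/

/-- The autocorrelation of the Hann window `2 cos²(πx)` on `[-1/2, 1/2]`, at lags in `[0, 1]`. -/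
noncomputable def hannCorr (u : ℝ) : ℝ :=
  (1 - u) * (1 + Real.cos (2 * Real.pi * u) / 2)
    + 3 / (4 * Real.pi) * Real.sin (2 * Real.pi * u)

/-- The combination `4 f + f'' / π²` of `f = hannCorr`. -/
noncomputable def hannSharp (u : ℝ) : ℝ :=
  4 * (1 - u) + 2 / Real.pi * Real.sin (2 * Real.pi * u)

theorem hasDerivAt_cos_two_pi_mul (u : ℝ) :
    HasDerivAt (fun u => Real.cos (2 * Real.pi * u))
      (-(2 * Real.pi) * Real.sin (2 * Real.pi * u)) u := by
  have h := ((hasDerivAt_id u).const_mul (2 * Real.pi)).cos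
  simp only [id_eq, mul_one] at h
  exact h.congr_deriv (by ring)

theorem hasDerivAt_sin_two_pi_mul (u : ℝ) :
    HasDerivAt (fun u => Real.sin (2 * Real.pi * u))
      (2 * Real.pi * Real.cos (2 * Real.pi * u)) u := by
  have h := ((hasDerivAt_id u).const_mul (2 * Real.pi)).sin
  simp only [id_eq, mul_one] at h
  exact h.congr_deriv (by ring)

theorem hasDerivAt_one_sub (u : ℝ) : HasDerivAt (fun u : ℝ => 1 - u) (-1) u :=
  (hasDerivAt_id u).const_sub 1

theorem hasDerivAt_hannCorr (u : ℝ) :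
    HasDerivAt hannCorr (-1 + Real.cos (2 * Real.pi * u)
      - Real.pi * (1 - u) * Real.sin (2 * Real.pi * u)) u := by
  have h := ((hasDerivAt_one_sub u).mul
    (((hasDerivAt_cos_two_pi_mul u).div_const 2).const_add 1)).add
    ((hasDerivAt_sin_two_pi_mul u).const_mul (3 / (4 * Real.pi)))
  refine h.congr_deriv ?_
  field_simp
  ring

theorem hasDerivAt_deriv_hannCorr (u : ℝ) :
    HasDerivAt (fun u => -1 + Real.cos (2 * Real.pi * u)
      - Real.pi * (1 - u) * Real.sin (2 * Real.pi * u))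
      (Real.pi ^ 2 * (hannSharp u - 4 * hannCorr u)) u := by
  have h := ((hasDerivAt_cos_two_pi_mul u).const_add (-1)).sub
    (((hasDerivAt_one_sub u).const_mul Real.pi).mul (hasDerivAt_sin_two_pi_mul u))
  refine h.congr_deriv ?_
  rw [hannSharp, hannCorr]
  field_simp
  ring

theorem hasDerivAt_hannSharp (u : ℝ) :
    HasDerivAt hannSharp (-4 + 4 * Real.cos (2 * Real.pi * u)) u := by
  have h := ((hasDerivAt_one_sub u).const_mul 4).add
    ((hasDerivAt_sin_two_pi_mul u).const_mul (2 / Real.pi))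
  refine h.congr_deriv ?_
  field_simp
  ring

theorem hasDerivAt_deriv_hannSharp (u : ℝ) :
    HasDerivAt (fun u => -4 + 4 * Real.cos (2 * Real.pi * u))
      (-(8 * Real.pi) * Real.sin (2 * Real.pi * u)) u :=
  (((hasDerivAt_cos_two_pi_mul u).const_mul 4).const_add (-4)).congr_deriv (by ring)

theorem continuous_hannCorr : Continuous hannCorr :=
  continuous_iff_continuousAt.2 fun u => (hasDerivAt_hannCorr u).continuousAt

theorem continuous_hannSharp : Continuous hannSharp :=
  continuous_iff_continuousAt.2 fun u => (hasDerivAt_hannSharp u).continuousAt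

@[simp] theorem hannCorr_zero : hannCorr 0 = 3 / 2 := by norm_num [hannCorr]

@[simp] theorem hannCorr_one : hannCorr 1 = 0 := by simp [hannCorr]

@[simp] theorem hannCorr_half : hannCorr (1 / 2) = 1 / 4 := by
  have h : 2 * Real.pi * (1 / 2) = Real.pi := by ring
  norm_num [hannCorr, h]

@[simp] theorem hannSharp_zero : hannSharp 0 = 4 := by norm_num [hannSharp]

@[simp] theorem hannSharp_one : hannSharp 1 = 0 := by simp [hannSharp]

@[simp] theorem hannSharp_half : hannSharp (1 / 2) = 2 := by
  have h : 2 * Real.pi * (1 / 2) = Real.pi := by ring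
  norm_num [hannSharp, h]

theorem mul_cos_le_sin {x : ℝ} (h0 : 0 ≤ x) (h1 : x ≤ Real.pi) :
    x * Real.cos x ≤ Real.sin x := by
  rcases lt_or_ge x (Real.pi / 2) with h | h
  · have hc : 0 < Real.cos x := Real.cos_pos_of_mem_Ioo ⟨by linarith [Real.pi_pos], h⟩
    have := Real.le_tan h0 h
    rwa [Real.tan_eq_sin_div_cos, le_div_iff₀ hc] at this
  · have hc : Real.cos x ≤ 0 := Real.cos_nonpos_of_pi_div_two_le_of_le h (by linarith)
    exact (mul_nonpos_of_nonneg_of_nonpos h0 hc).trans (Real.sin_nonneg_of_nonneg_of_le_pi h0 h1)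

theorem antitoneOn_hannCorr : AntitoneOn hannCorr (Set.Icc 0 1) := by
  refine antitoneOn_of_hasDerivWithinAt_nonpos (convex_Icc 0 1) continuous_hannCorr.continuousOn
    (fun u _ => (hasDerivAt_hannCorr u).hasDerivWithinAt) fun u hu => ?_
  rw [interior_Icc] at hu
  -- In terms of `x` the derivative is `-2 sin x (sin x - x cos x)`.
  set x := Real.pi * (1 - u) with hx
  have h2 : 2 * Real.pi * u = 2 * Real.pi - 2 * x := by rw [hx]; ring
  rw [h2, Real.cos_two_pi_sub, Real.sin_two_pi_sub, Real.cos_two_mul, Real.sin_two_mul]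
  have hx0 : 0 ≤ x := mul_nonneg Real.pi_pos.le (by linarith [hu.2])
  have hx1 : x ≤ Real.pi := by nlinarith [Real.pi_pos, hu.1]
  have h3 := mul_nonneg (Real.sin_nonneg_of_nonneg_of_le_pi hx0 hx1)
    (sub_nonneg.2 (mul_cos_le_sin hx0 hx1))
  nlinarith [Real.sin_sq_add_cos_sq x]

theorem antitone_hannSharp : Antitone hannSharp := by
  refine antitone_of_hasDerivAt_nonpos hasDerivAt_hannSharp fun u => ?_
  show -4 + 4 * Real.cos (2 * Real.pi * u) ≤ 0
  linarith [Real.cos_le_one (2 * Real.pi * u)]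

/-- The right side is `16 (3/4 - hannKernel u 0)`, so this gives the constant `5/4 = 20/16` in the
quadratic decay of the kernel. -/
theorem quadratic_le_hann {u : ℝ} (h0 : 0 ≤ u) (h1 : u ≤ 1 / 2) :
    20 * u ^ 2 ≤ 12 - (3 / 2 * hannSharp u + 4 * hannCorr u) := by
  have hpi := Real.pi_gt_three
  have e : 12 - (3 / 2 * hannSharp u + 4 * hannCorr u)
      = 4 * (1 - u) * Real.sin (Real.pi * u) ^ 2
        + (12 * u - 6 / Real.pi * Real.sin (2 * Real.pi * u)) := by
    rw [hannSharp, hannCorr, show 2 * Real.pi * u = 2 * (Real.pi * u) by ring,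
      Real.cos_two_mul, Real.cos_sq']
    field_simp
    ring
  rw [e]
  rcases le_total u (1 / 4) with h | h
  · have hs : Real.sin (2 * Real.pi * u) ≤ 2 * Real.pi * u := Real.sin_le (by positivity)
    have hs1 : 6 / Real.pi * Real.sin (2 * Real.pi * u) ≤ 12 * u := by
      calc _ ≤ 6 / Real.pi * (2 * Real.pi * u) := by gcongr
        _ = 12 * u := by field_simp; ring
    -- The chord of the sine from `0` to `π/4` gives `sin² (πu) ≥ 8u²`, and then `4 (1 - u) * 8u² ≥
    -- 24u²` for `u ≤ 1/4`.
    have hc := strictConcaveOn_sin_Icc.concaveOn.2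
      (⟨le_rfl, by positivity⟩ : (0 : ℝ) ∈ Set.Icc 0 Real.pi)
      (⟨by positivity, by linarith⟩ : Real.pi / 4 ∈ Set.Icc 0 Real.pi)
      (by linarith : 0 ≤ 1 - 4 * u) (by linarith : 0 ≤ 4 * u) (by ring)
    simp only [smul_eq_mul, Real.sin_zero, mul_zero, zero_add, Real.sin_pi_div_four] at hc
    rw [show 4 * u * (Real.pi / 4) = Real.pi * u by ring] at hc
    have hsq : 8 * u ^ 2 ≤ Real.sin (Real.pi * u) ^ 2 := by
      calc 8 * u ^ 2 = (4 * u * (√2 / 2)) ^ 2 := by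
            rw [mul_pow, div_pow, Real.sq_sqrt (by norm_num)]; ring
        _ ≤ _ := by gcongr
    nlinarith [mul_nonneg (sub_nonneg.2 hsq) (by linarith : 0 ≤ 1 - u),
      mul_nonneg (sq_nonneg u) (by linarith : 0 ≤ 1 / 4 - u)]
  · have hs1 : 6 / Real.pi * Real.sin (2 * Real.pi * u) ≤ 2 := by
      calc 6 / Real.pi * Real.sin (2 * Real.pi * u) ≤ 6 / Real.pi * 1 := by
            gcongr; exact Real.sin_le_one _
        _ ≤ 2 := by rw [mul_one, div_le_iff₀ (by positivity)]; linarith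
    have hsq : 1 / 2 ≤ Real.sin (Real.pi * u) ^ 2 := by
      rw [Real.sin_sq_eq_half_sub, show 2 * (Real.pi * u) = 2 * Real.pi * u by ring]
      have : Real.cos (2 * Real.pi * u) ≤ 0 :=
        Real.cos_nonpos_of_pi_div_two_le_of_le (by nlinarith) (by nlinarith)
      linarith
    -- Here the sum is at least `2 (1 - u) + 12u - 2 = 10u ≥ 20u²`, since `u ≤ 1/2`.
    nlinarith [mul_nonneg (sub_nonneg.2 hsq) (by linarith : 0 ≤ 1 - u)]

/-! ### Cosine transforms of the profiles -/

/-- The cosine transform of a function on `[0, 1]`. -/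
noncomputable def cosTransform (f : ℝ → ℝ) (ω : ℝ) : ℝ :=
  ∫ u in (0 : ℝ)..1, f u * Real.cos (ω * u)

/-- Two integrations by parts; the endpoint conditions remove every boundary term. -/
theorem cosTransform_deriv_deriv {f f' f'' : ℝ → ℝ} (hf : ∀ u, HasDerivAt f (f' u) u)
    (hf' : ∀ u, HasDerivAt f' (f'' u) u) (hc : Continuous f'') (h1 : f 1 = 0) (h0' : f' 0 = 0)
    (h1' : f' 1 = 0) (ω : ℝ) : cosTransform f'' ω = -ω ^ 2 * cosTransform f ω := by
  have hcf : Continuous f := continuous_iff_continuousAt.2 fun u => (hf u).continuousAt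
  have hd : ∀ u ∈ Set.uIcc (0 : ℝ) 1,
      HasDerivAt (fun u => f' u * Real.cos (ω * u) + ω * (f u * Real.sin (ω * u)))
        (f'' u * Real.cos (ω * u) + ω ^ 2 * (f u * Real.cos (ω * u))) u := by
    intro u _
    have hl := (hasDerivAt_id u).const_mul ω
    refine (((hf' u).mul hl.cos).add (((hf u).mul hl.sin).const_mul ω)).congr_deriv ?_
    simp only [id_eq]
    ring
  have hi := intervalIntegral.integral_eq_sub_of_hasDerivAt hd
    (Continuous.intervalIntegrable (by fun_prop) _ _)
  rw [intervalIntegral.integral_add (Continuous.intervalIntegrable (by fun_prop) _ _)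
    (Continuous.intervalIntegrable (by fun_prop) _ _), intervalIntegral.integral_const_mul] at hi
  simp only [h1, h0', h1', mul_zero, zero_mul, Real.sin_zero, add_zero, sub_zero] at hi
  rw [cosTransform, cosTransform]
  linarith

theorem abs_cosTransform_le {f : ℝ → ℝ} {C : ℝ} (hf : ∀ u ∈ Set.Icc (0 : ℝ) 1, |f u| ≤ C) (ω : ℝ) :
    |cosTransform f ω| ≤ C := by
  have := intervalIntegral.norm_integral_le_of_norm_le_const (a := 0) (b := 1) (C := C)
    (f := fun u => f u * Real.cos (ω * u)) fun u hu => by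
      rw [Set.uIoc_of_le zero_le_one] at hu
      rw [norm_mul, Real.norm_eq_abs, Real.norm_eq_abs]
      have h := hf u ⟨hu.1.le, hu.2⟩
      exact (mul_le_of_le_one_right (abs_nonneg _) (Real.abs_cos_le_one _)).trans h
  simpa [cosTransform] using this

theorem cosTransform_hannSharp (ω : ℝ) :
    Real.pi ^ 2 * cosTransform hannSharp ω
      = (4 * Real.pi ^ 2 - ω ^ 2) * cosTransform hannCorr ω := by
  have h := cosTransform_deriv_deriv hasDerivAt_hannCorr hasDerivAt_deriv_hannCorr
    ((continuous_hannSharp.sub (continuous_hannCorr.const_mul 4)).const_mul _)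
    hannCorr_one (by simp) (by simp) ω
  have h2 : cosTransform (fun u => Real.pi ^ 2 * (hannSharp u - 4 * hannCorr u)) ω
      = Real.pi ^ 2 * cosTransform hannSharp ω - 4 * Real.pi ^ 2 * cosTransform hannCorr ω := by
    have c1 := continuous_hannSharp
    have c2 := continuous_hannCorr
    simp only [cosTransform]
    rw [← intervalIntegral.integral_const_mul, ← intervalIntegral.integral_const_mul,
      ← intervalIntegral.integral_sub (Continuous.intervalIntegrable (by fun_prop) _ _)
        (Continuous.intervalIntegrable (by fun_prop) _ _)]
    congr 1
    ext u
    ring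
  linarith

theorem cosTransform_deriv_deriv_hannSharp (ω : ℝ) :
    cosTransform (fun u => -(8 * Real.pi) * Real.sin (2 * Real.pi * u)) ω
      = -ω ^ 2 * cosTransform hannSharp ω :=
  cosTransform_deriv_deriv hasDerivAt_hannSharp hasDerivAt_deriv_hannSharp (by fun_prop)
    hannSharp_one (by simp) (by simp) ω

theorem cosTransform_sin (ω : ℝ) :
    (4 * Real.pi ^ 2 - ω ^ 2)
      * cosTransform (fun u => -(8 * Real.pi) * Real.sin (2 * Real.pi * u)) ω
      = -(16 * Real.pi ^ 2) * (1 - Real.cos ω) := by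
  have hd : ∀ u ∈ Set.uIcc (0 : ℝ) 1,
      HasDerivAt (fun u => 8 * Real.pi * (2 * Real.pi * (Real.cos (2 * Real.pi * u)
          * Real.cos (ω * u)) + ω * (Real.sin (2 * Real.pi * u) * Real.sin (ω * u))))
        ((4 * Real.pi ^ 2 - ω ^ 2)
          * (-(8 * Real.pi) * Real.sin (2 * Real.pi * u) * Real.cos (ω * u))) u := by
    intro u _
    have hl := (hasDerivAt_id u).const_mul ω
    refine (((((hasDerivAt_cos_two_pi_mul u).mul hl.cos).const_mul (2 * Real.pi)).add
      (((hasDerivAt_sin_two_pi_mul u).mul hl.sin).const_mul ω)).const_mul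
        (8 * Real.pi)).congr_deriv ?_
    simp only [id_eq]
    ring
  have hi := intervalIntegral.integral_eq_sub_of_hasDerivAt hd
    (Continuous.intervalIntegrable (by fun_prop) _ _)
  rw [intervalIntegral.integral_const_mul] at hi
  rw [cosTransform, hi]
  simp
  ring

theorem hannCorr_nonneg {u : ℝ} (hu : u ∈ Set.Icc (0 : ℝ) 1) : 0 ≤ hannCorr u := by
  simpa using antitoneOn_hannCorr hu (Set.right_mem_Icc.2 zero_le_one) hu.2

/-- Combining the transform identities gives the closed form `16π⁴ (1 - cos ω) / (ω² (4π² - ω²)²)`.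
It degenerates at `ω = ±2π`; the frequencies used later never meet these points. -/
theorem cosTransform_hannCorr_nonneg {ω : ℝ} (hω : ω ^ 2 ≠ 4 * Real.pi ^ 2) :
    0 ≤ cosTransform hannCorr ω := by
  rcases eq_or_ne ω 0 with rfl | h0
  · refine intervalIntegral.integral_nonneg zero_le_one fun u hu => ?_
    simpa using hannCorr_nonneg hu
  have h : Real.pi ^ 2 * (16 * Real.pi ^ 2 * (1 - Real.cos ω))
      = cosTransform hannCorr ω * (ω ^ 2 * (4 * Real.pi ^ 2 - ω ^ 2) ^ 2) := by
    linear_combination Real.pi ^ 2 * cosTransform_sin ω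
      - Real.pi ^ 2 * (4 * Real.pi ^ 2 - ω ^ 2) * cosTransform_deriv_deriv_hannSharp ω
      + ω ^ 2 * (4 * Real.pi ^ 2 - ω ^ 2) * cosTransform_hannSharp ω
  have hp : 0 < ω ^ 2 * (4 * Real.pi ^ 2 - ω ^ 2) ^ 2 := by
    have := sub_ne_zero.2 hω.symm
    positivity
  refine nonneg_of_mul_nonneg_left (h ▸ ?_) hp
  have := sub_nonneg.2 (Real.cos_le_one ω)
  positivity

theorem integral_hannCorr : ∫ u in (0 : ℝ)..1, hannCorr u = 1 / 2 := by
  have h := cosTransform_hannSharp 0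
  have h2 : cosTransform hannSharp 0 = 2 := by
    have hd : ∀ u ∈ Set.uIcc (0 : ℝ) 1, HasDerivAt
        (fun u => -2 * (1 - u) ^ 2 - Real.cos (2 * Real.pi * u) / Real.pi ^ 2) (hannSharp u) u := by
      intro u _
      refine ((((hasDerivAt_one_sub u).pow 2).const_mul (-2)).sub
        ((hasDerivAt_cos_two_pi_mul u).div_const (Real.pi ^ 2))).congr_deriv ?_
      rw [hannSharp]
      field_simp
      ring
    have hi := intervalIntegral.integral_eq_sub_of_hasDerivAt hd
      (continuous_hannSharp.intervalIntegrable _ _)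
    simp only [cosTransform, zero_mul, Real.cos_zero, mul_one, hi]
    simp
    ring
  rw [h2] at h
  have h3 : cosTransform hannCorr 0 = 1 / 2 := by
    have := Real.pi_pos
    have h4 : Real.pi ^ 2 * (4 * cosTransform hannCorr 0 - 2) = 0 := by linear_combination -h
    linarith [(mul_eq_zero.1 h4).resolve_left (by positivity)]
  simpa [cosTransform] using h3

theorem cosTransform_hannCorr_le (ω : ℝ) : cosTransform hannCorr ω ≤ 1 / 2 := by
  rw [← integral_hannCorr]
  have c2 := continuous_hannCorr
  refine intervalIntegral.integral_mono_on zero_le_one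
    (Continuous.intervalIntegrable (by fun_prop) _ _)
    (Continuous.intervalIntegrable (by fun_prop) _ _) fun u hu => ?_
  exact mul_le_of_le_one_right (hannCorr_nonneg hu) (Real.cos_le_one _)

/-- Both second derivatives are bounded on `[0, 1]`. The resulting `ω⁻²` decay makes the Fourier
series absolutely summable. -/
theorem exists_cosTransform_hann_bound : ∃ C, ∀ ω,
    |ω ^ 2 * cosTransform hannCorr ω| ≤ C ∧ |ω ^ 2 * cosTransform hannSharp ω| ≤ C := by
  have h := cosTransform_deriv_deriv hasDerivAt_hannCorr hasDerivAt_deriv_hannCorr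
    ((continuous_hannSharp.sub (continuous_hannCorr.const_mul 4)).const_mul _)
    hannCorr_one (by simp) (by simp)
  obtain ⟨C, hC⟩ := isCompact_Icc.exists_bound_of_continuousOn (s := Set.Icc (0 : ℝ) 1)
    ((continuous_hannSharp.sub (continuous_hannCorr.const_mul 4)).const_mul
      (Real.pi ^ 2)).continuousOn
  refine ⟨max C (8 * Real.pi), fun ω => ⟨?_, ?_⟩⟩
  · rw [← abs_neg, ← neg_mul, ← h]
    exact (abs_cosTransform_le hC ω).trans (le_max_left _ _)
  · rw [← abs_neg, ← neg_mul, ← cosTransform_deriv_deriv_hannSharp]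
    refine (abs_cosTransform_le (fun u _ => ?_) ω).trans (le_max_right _ _)
    rw [abs_mul, abs_neg, abs_of_pos (by positivity : 0 < 8 * Real.pi)]
    exact mul_le_of_le_one_right (by positivity) (Real.abs_sin_le_one _)

/-! ### Fourier series of an even bump on the circle -/

theorem continuous_comp_min_norm {f : ℝ → ℝ} (hf : Continuous f) (L : ℝ) :
    Continuous fun x : UnitAddCircle => ((f (min (‖x‖ / L) 1) : ℝ) : ℂ) := by
  fun_prop

theorem norm_coe_unitAddCircle_of_mem {x : ℝ} (hx : |x| ≤ 1 / 2) : ‖(x : UnitAddCircle)‖ = |x| :=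
  (AddCircle.norm_coe_eq_abs_iff 1 one_ne_zero).2 (by simpa using hx)

/-- Truncating with `min` extends the profile by `f 1 = 0`, and `L ≤ 1 / 2` keeps the bump inside
one period. Folding by evenness and rescaling by `L` leaves a cosine transform. -/
theorem fourierCoeff_comp_min_norm {f : ℝ → ℝ} (hf : Continuous f) (h1 : f 1 = 0) {L : ℝ}
    (hL : 0 < L) (hL2 : L ≤ 1 / 2) (n : ℤ) :
    fourierCoeff (fun x : UnitAddCircle => ((f (min (‖x‖ / L) 1) : ℝ) : ℂ)) n
      = ((2 * L * cosTransform f (2 * Real.pi * (L * n)) : ℝ) : ℂ) := by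
  set g : ℝ → ℂ := fun x => ((f (min (|x| / L) 1) : ℝ) : ℂ) with hg
  have hgc : Continuous g := by rw [hg]; fun_prop
  set e : ℝ → ℂ := fun x => Complex.exp (-(2 * Real.pi * n * x : ℝ) * Complex.I) with he
  have hec : Continuous e := by rw [he]; fun_prop
  have hint : ∀ a b, IntervalIntegrable (fun x => e x * g x) volume a b := fun a b =>
    (hec.mul hgc).intervalIntegrable a b
  have hint' : ∀ a b, IntervalIntegrable (fun x => e (-x) * g x) volume a b := fun a b =>
    ((hec.comp continuous_neg).mul hgc).intervalIntegrable a b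
  have hsum : ∀ x, e (-x) * g x + e x * g x
      = ((2 * (f (min (|x| / L) 1) * Real.cos (2 * Real.pi * n * x)) : ℝ) : ℂ) := by
    intro x
    have h2 := Complex.two_cos ((2 * Real.pi * n * x : ℝ) : ℂ)
    have e1 : e (-x) = Complex.exp ((2 * Real.pi * n * x : ℝ) * Complex.I) := by
      simp only [he]; congr 1; push_cast; ring
    rw [← add_mul, e1, he, hg, ← h2]
    push_cast
    ring
  have step1 : fourierCoeff (fun x : UnitAddCircle => ((f (min (‖x‖ / L) 1) : ℝ) : ℂ)) n
      = ∫ x in (-(1 / 2) : ℝ)..(1 / 2), e x * g x := by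
    rw [fourierCoeff_eq_intervalIntegral _ n (-(1 / 2)), show (-(1 / 2) : ℝ) + 1 = 1 / 2 by norm_num]
    simp only [div_one, one_smul, smul_eq_mul]
    refine intervalIntegral.integral_congr fun x hx => ?_
    rw [Set.uIcc_of_le (by norm_num)] at hx
    simp only [norm_coe_unitAddCircle_of_mem (abs_le.2 hx), fourier_coe_apply, he, hg]
    congr 2
    push_cast
    ring
  have step2 : ∫ x in (-(1 / 2) : ℝ)..(1 / 2), e x * g x
      = ∫ x in (0 : ℝ)..(1 / 2), (e (-x) * g x + e x * g x) := by
    rw [intervalIntegral.integral_add (hint' _ _) (hint _ _),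
      ← intervalIntegral.integral_add_adjacent_intervals (hint (-(1 / 2)) 0) (hint 0 (1 / 2))]
    congr 1
    have h := intervalIntegral.integral_comp_neg (a := 0) (b := 1 / 2) fun x => e x * g x
    rw [neg_zero] at h
    rw [← h]
    simp only [hg, abs_neg]
  rw [step1, step2]
  simp_rw [hsum]
  rw [intervalIntegral.integral_ofReal]
  congr 1
  have hc : Continuous fun x => 2 * (f (min (|x| / L) 1) * Real.cos (2 * Real.pi * n * x)) := by
    fun_prop
  rw [← intervalIntegral.integral_add_adjacent_intervals (hc.intervalIntegrable 0 L)
    (hc.intervalIntegrable L (1 / 2))]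
  have hz : ∫ x in L..(1 / 2), 2 * (f (min (|x| / L) 1) * Real.cos (2 * Real.pi * n * x)) = 0 := by
    rw [intervalIntegral.integral_congr (g := fun _ => (0 : ℝ)), intervalIntegral.integral_zero]
    intro x hx
    rw [Set.uIcc_of_le hL2] at hx
    have : min (|x| / L) 1 = 1 := by
      rw [abs_of_nonneg (hL.le.trans hx.1)]
      exact min_eq_right ((one_le_div hL).2 hx.1)
    simp only [this, h1, zero_mul, mul_zero]
  rw [hz, add_zero]
  have hs := intervalIntegral.mul_integral_comp_mul_left (a := 0) (b := 1) (c := L)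
    (f := fun x => 2 * (f (min (|x| / L) 1) * Real.cos (2 * Real.pi * n * x)))
  rw [mul_zero, mul_one] at hs
  rw [← hs, intervalIntegral.integral_const_mul, cosTransform]
  rw [← mul_assoc, mul_comm L 2]
  congr 1
  refine intervalIntegral.integral_congr fun u hu => ?_
  rw [Set.uIcc_of_le zero_le_one] at hu
  have : min (|L * u| / L) 1 = u := by
    rw [abs_of_nonneg (mul_nonneg hL.le hu.1), mul_div_cancel_left₀ _ hL.ne', min_eq_left hu.2]
  simp only [this]
  ring_nf

theorem summable_cosTransform {f : ℝ → ℝ} {C : ℝ} (hC : ∀ ω, |ω ^ 2 * cosTransform f ω| ≤ C)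
    {L : ℝ} (hL : 0 < L) :
    Summable fun n : ℤ => 2 * L * cosTransform f (2 * Real.pi * (L * n)) := by
  refine Summable.mul_left _ ?_
  have hs : Summable fun n : ℤ => C / (2 * Real.pi * L) ^ 2 * (1 / (n : ℝ) ^ 2) :=
    (Real.summable_one_div_int_pow.2 one_lt_two).mul_left _
  refine Summable.of_norm_bounded_eventually hs ?_
  filter_upwards [(Set.finite_singleton (0 : ℤ)).compl_mem_cofinite] with n hn
  have hn' : (n : ℝ) ≠ 0 := by exact_mod_cast hn
  have h := hC (2 * Real.pi * (L * n))
  have hp : 0 < (2 * Real.pi * (L * n)) ^ 2 := by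
    have := Real.pi_pos
    positivity
  rw [abs_mul, abs_of_pos hp, mul_comm, ← le_div_iff₀ hp] at h
  refine h.trans (le_of_eq ?_)
  field_simp

theorem hasSum_fourier_comp_min_norm {f : ℝ → ℝ} (hf : Continuous f) (h1 : f 1 = 0) {C : ℝ}
    (hC : ∀ ω, |ω ^ 2 * cosTransform f ω| ≤ C) {L : ℝ} (hL : 0 < L) (hL2 : L ≤ 1 / 2)
    (x : UnitAddCircle) :
    HasSum (fun n : ℤ => ((2 * L * cosTransform f (2 * Real.pi * (L * n)) : ℝ) : ℂ) * fourier n x)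
      ((f (min (‖x‖ / L) 1) : ℝ) : ℂ) := by
  have hco := fourierCoeff_comp_min_norm hf h1 hL hL2
  have hs := has_pointwise_sum_fourier_series_of_summable
    (f := ⟨_, continuous_comp_min_norm hf L⟩) (by
      refine Summable.congr ?_ fun n => (hco n).symm
      exact Complex.ofRealCLM.summable (summable_cosTransform hC hL)) x
  simp only [ContinuousMap.coe_mk, hco, smul_eq_mul] at hs
  exact hs

/-! ### The kernel on the two-dimensional torus -/

/-- A product-type kernel on `[0, 1]²` built from the Hann window. -/
noncomputable def hannKernel (u v : ℝ) : ℝ :=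
  1 / 16 * (hannSharp u * hannCorr v + hannCorr u * hannSharp v)

theorem hannKernel_comm (u v : ℝ) : hannKernel u v = hannKernel v u := by
  rw [hannKernel, hannKernel]; ring

theorem hannSharp_nonneg {u : ℝ} (hu : u ≤ 1) : 0 ≤ hannSharp u := by
  simpa using antitone_hannSharp hu

theorem hannKernel_anti {u u' v v' : ℝ} (hu : 0 ≤ u) (huu : u ≤ u') (hu' : u' ≤ 1) (hv : 0 ≤ v)
    (hvv : v ≤ v') (hv' : v' ≤ 1) : hannKernel u' v' ≤ hannKernel u v := by
  have h1 := antitone_hannSharp huu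
  have h2 := antitone_hannSharp hvv
  have h3 := antitoneOn_hannCorr ⟨hu, huu.trans hu'⟩ ⟨hu.trans huu, hu'⟩ huu
  have h4 := antitoneOn_hannCorr ⟨hv, hvv.trans hv'⟩ ⟨hv.trans hvv, hv'⟩ hvv
  have p1 := hannSharp_nonneg hu'
  have p2 := hannSharp_nonneg hv'
  have p3 := hannCorr_nonneg ⟨hu.trans huu, hu'⟩
  have p4 := hannCorr_nonneg ⟨hv.trans hvv, hv'⟩
  rw [hannKernel, hannKernel]
  have h5 := p1.trans h1
  have h6 := p3.trans h3
  gcongr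

/-- The kernel on the torus with profile `hannKernel` in the coordinate norms, supported where
`‖x‖ ≤ L`. -/
noncomputable def torusKernel (L : ℝ) (x : UnitAddTorus (Fin 2)) : ℝ :=
  hannKernel (min (‖x 0‖ / L) 1) (min (‖x 1‖ / L) 1)

section TorusKernel

variable {L : ℝ} {x : UnitAddTorus (Fin 2)}

theorem torusKernel_neg : torusKernel L (-x) = torusKernel L x := by
  simp [torusKernel]

theorem torusKernel_zero : torusKernel L 0 = 3 / 4 := by
  norm_num [torusKernel, hannKernel]

theorem torusKernel_nonneg (hL : 0 < L) : 0 ≤ torusKernel L x := by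
  have := hannKernel_anti (u := min (‖x 0‖ / L) 1) (v := min (‖x 1‖ / L) 1) (u' := 1) (v' := 1)
    (by positivity) (min_le_right _ _) le_rfl (by positivity) (min_le_right _ _) le_rfl
  simpa [torusKernel, hannKernel] using this

theorem exists_norm_eq_norm_apply (x : UnitAddTorus (Fin 2)) : ∃ i, ‖x‖ = ‖x i‖ := by
  rcases (norm_nonneg x).eq_or_lt with h | h
  · exact ⟨0, le_antisymm (h ▸ norm_nonneg _) (norm_le_pi_norm x 0)⟩
  · by_contra! hne
    exact lt_irrefl _ ((pi_norm_lt_iff h).2 fun i => (norm_le_pi_norm x i).lt_of_ne (hne i).symm)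

/-- One coordinate realizes the sup norm; by monotonicity, replacing the other by `0` only increases
the kernel. -/
theorem torusKernel_le (hL : 0 < L) :
    torusKernel L x ≤ hannKernel (min (‖x‖ / L) 1) 0 := by
  obtain ⟨i, hi⟩ := exists_norm_eq_norm_apply x
  rw [hi, torusKernel]
  fin_cases i
  · exact hannKernel_anti (by positivity) le_rfl (min_le_right _ _) le_rfl (by positivity)
      (min_le_right _ _)
  · rw [hannKernel_comm]
    exact hannKernel_anti (by positivity) le_rfl (min_le_right _ _) le_rfl (by positivity)
      (min_le_right _ _)

theorem torusKernel_eq_zero (hL : 0 < L) (h : L ≤ ‖x‖) : torusKernel L x = 0 := by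
  refine le_antisymm ((torusKernel_le hL).trans_eq ?_) (torusKernel_nonneg hL)
  rw [min_eq_right ((one_le_div hL).2 h)]
  simp [hannKernel]

theorem torusKernel_le_quarter (hL : 0 < L) (h : L / 2 ≤ ‖x‖) : torusKernel L x ≤ 1 / 4 := by
  refine (torusKernel_le hL).trans ?_
  have h2 : 1 / 2 ≤ ‖x‖ / L := by rw [le_div_iff₀ hL]; linarith
  refine (hannKernel_anti (u := 1 / 2) (v := 0) (by norm_num) (le_min h2 (by norm_num))
    (min_le_right _ _) le_rfl le_rfl zero_le_one).trans ?_
  norm_num [hannKernel, -one_div]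

theorem le_torusKernel (hL : 0 < L) (h : ‖x‖ ≤ L / 2) : 1 / 16 ≤ torusKernel L x := by
  have h2 : ∀ i, min (‖x i‖ / L) 1 ≤ 1 / 2 := fun i => (min_le_left _ _).trans <| by
    rw [div_le_iff₀ hL]; linarith [norm_le_pi_norm x i]
  have := hannKernel_anti (u := min (‖x 0‖ / L) 1) (v := min (‖x 1‖ / L) 1) (u' := 1 / 2)
    (v' := 1 / 2) (by positivity) (h2 0) (by norm_num) (by positivity) (h2 1) (by norm_num)
  refine le_trans ?_ this
  norm_num [hannKernel, -one_div]

theorem torusKernel_add_le (hL : 0 < L) (h : ‖x‖ ≤ L / 2) :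
    torusKernel L x + 5 / 4 * (‖x‖ / L) ^ 2 ≤ 3 / 4 := by
  have h2 : ‖x‖ / L ≤ 1 / 2 := by rw [div_le_iff₀ hL]; linarith
  have h3 := torusKernel_le (x := x) hL
  rw [min_eq_left (h2.trans (by norm_num)), hannKernel] at h3
  have h4 := quadratic_le_hann (by positivity) h2
  simp only [hannCorr_zero, hannSharp_zero] at h3
  linarith

/-- The Fourier coefficients of `torusKernel`. -/
noncomputable def torusKernelCoeff (L : ℝ) (k : Fin 2 → ℤ) : ℝ :=
  L ^ 2 / 4 * (cosTransform hannSharp (2 * Real.pi * (L * k 0))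
      * cosTransform hannCorr (2 * Real.pi * (L * k 1))
    + cosTransform hannCorr (2 * Real.pi * (L * k 0))
      * cosTransform hannSharp (2 * Real.pi * (L * k 1)))

theorem HasSum.mul_complex {f g : ℤ → ℂ} {A B : ℂ} (hf : HasSum f A) (hg : HasSum g B) :
    HasSum (fun k : Fin 2 → ℤ => f (k 0) * g (k 1)) (A * B) := by
  have hs : Summable fun p : ℤ × ℤ => f p.1 * g p.2 :=
    summable_mul_of_summable_norm (f := f) (g := g) hf.summable.norm hg.summable.norm
  exact (finTwoArrowEquiv ℤ).hasSum_iff.2 (hf.mul hg hs)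

theorem hasSum_mul_mFourier {a b : ℤ → ℂ} {x : UnitAddTorus (Fin 2)} {A B : ℂ}
    (ha : HasSum (fun n => a n * fourier n (x 0)) A)
    (hb : HasSum (fun n => b n * fourier n (x 1)) B) :
    HasSum (fun k : Fin 2 → ℤ => a (k 0) * b (k 1) * UnitAddTorus.mFourier k x) (A * B) := by
  refine (ha.mul_complex hb).congr_fun fun k => ?_
  simp only [UnitAddTorus.mFourier, ContinuousMap.coe_mk, Fin.prod_univ_two]
  ring

theorem hasSum_torusKernel (hL : 0 < L) (hL2 : L ≤ 1 / 2) (x : UnitAddTorus (Fin 2)) :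
    HasSum (fun k : Fin 2 → ℤ => (torusKernelCoeff L k : ℂ) * UnitAddTorus.mFourier k x)
      (torusKernel L x : ℂ) := by
  obtain ⟨C, hC⟩ := exists_cosTransform_hann_bound
  have hH := hasSum_fourier_comp_min_norm continuous_hannCorr hannCorr_one (fun ω => (hC ω).1)
    hL hL2
  have hM := hasSum_fourier_comp_min_norm continuous_hannSharp hannSharp_one (fun ω => (hC ω).2)
    hL hL2
  have h3 := ((hasSum_mul_mFourier (hM (x 0)) (hH (x 1))).add
    (hasSum_mul_mFourier (hH (x 0)) (hM (x 1)))).mul_left (1 / 16 : ℂ)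
  have h4 : (torusKernel L x : ℂ) = 1 / 16
      * ((hannSharp (min (‖x 0‖ / L) 1) : ℂ) * (hannCorr (min (‖x 1‖ / L) 1) : ℂ)
        + (hannCorr (min (‖x 0‖ / L) 1) : ℂ) * (hannSharp (min (‖x 1‖ / L) 1) : ℂ)) := by
    rw [torusKernel, hannKernel]
    push_cast
    ring
  rw [h4]
  refine h3.congr_fun fun k => ?_
  simp only [torusKernelCoeff]
  push_cast
  ring

/-- The transform of `hannSharp` at `2πLn` is `4 (1 - L²n²)` times that of `hannCorr`; adding the
two coordinates produces the Euclidean norm of `k`. -/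
theorem torusKernelCoeff_eq (L : ℝ) (k : Fin 2 → ℤ) :
    torusKernelCoeff L k = L ^ 2 * (cosTransform hannCorr (2 * Real.pi * (L * k 0))
      * cosTransform hannCorr (2 * Real.pi * (L * k 1)))
        * (2 - L ^ 2 * ((k 0 : ℝ) ^ 2 + (k 1 : ℝ) ^ 2)) := by
  have h : ∀ n : ℤ, cosTransform hannSharp (2 * Real.pi * (L * n))
      = 4 * (1 - L ^ 2 * n ^ 2) * cosTransform hannCorr (2 * Real.pi * (L * n)) := by
    intro n
    have := cosTransform_hannSharp (2 * Real.pi * (L * n))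
    refine mul_left_cancel₀ (by positivity : Real.pi ^ 2 ≠ 0) (this.trans ?_)
    ring
  rw [torusKernelCoeff, h, h]
  ring

end TorusKernel

/-! ### Minorant of the low-pass indicator -/

/-- Irrationality of `√2` keeps `2πLn` away from `±2π`, where the closed form of the transform
degenerates. -/
theorem two_mul_sq_ne_sq {N : ℕ} (hN : 0 < N) (n : ℤ) : 2 * (n : ℝ) ^ 2 ≠ (N : ℝ) ^ 2 := by
  intro h
  have hN' : (0 : ℝ) < N := by exact_mod_cast hN
  have hn : (n : ℝ) ≠ 0 := by
    intro h0
    rw [h0] at h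
    nlinarith
  have h2 : √2 = |(N : ℝ) / n| := by
    rw [← Real.sqrt_sq_eq_abs, div_pow, ← h, mul_div_cancel_right₀ _ (pow_ne_zero 2 hn)]
  refine irrational_sqrt_two ⟨|(N : ℚ) / n|, ?_⟩
  rw [h2]
  push_cast
  rfl

/-- With `L² = 2 / N²` the left side is `4 f̂ f̂ (1 - |k|² / N²)`, where `0 ≤ f̂ ≤ 1/2`. -/
theorem sq_mul_torusKernelCoeff_le {N : ℕ} (hN : 0 < N) (k : Fin 2 → ℤ) :
    (N : ℝ) ^ 2 * torusKernelCoeff (√2 / N) k ≤ if k ∈ lowPass 2 N then 1 else 0 := by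
  have hN' : (0 : ℝ) < N := by exact_mod_cast hN
  have hL : (√2 / N) ^ 2 = 2 / (N : ℝ) ^ 2 := by rw [div_pow, Real.sq_sqrt (by norm_num)]
  have hpos : ∀ n : ℤ, 0 ≤ cosTransform hannCorr (2 * Real.pi * (√2 / N * n)) := by
    intro n
    refine cosTransform_hannCorr_nonneg fun h => two_mul_sq_ne_sq hN n ?_
    have h2 : (2 * Real.pi * (√2 / N * n)) ^ 2
        = 4 * Real.pi ^ 2 * (2 * (n : ℝ) ^ 2 / (N : ℝ) ^ 2) := by
      rw [mul_pow, mul_pow (√2 / N), hL]; ring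
    rw [h2] at h
    have h3 := mul_left_cancel₀ (by positivity : 4 * Real.pi ^ 2 ≠ 0) (h.trans (mul_one _).symm)
    rwa [div_eq_one_iff_eq (by positivity)] at h3
  have hle : ∀ n : ℤ, cosTransform hannCorr (2 * Real.pi * (√2 / N * n)) ≤ 1 / 2 :=
    fun n => cosTransform_hannCorr_le _
  have e : (N : ℝ) ^ 2 * torusKernelCoeff (√2 / N) k
      = 4 * (cosTransform hannCorr (2 * Real.pi * (√2 / N * k 0))
      * cosTransform hannCorr (2 * Real.pi * (√2 / N * k 1)))
        * (((N : ℝ) ^ 2 - ((k 0 : ℝ) ^ 2 + (k 1 : ℝ) ^ 2)) / (N : ℝ) ^ 2) := by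
    rw [torusKernelCoeff_eq, hL]
    field_simp
    ring
  rw [e]
  have hp := mul_nonneg (hpos (k 0)) (hpos (k 1))
  have hp1 := mul_le_mul (hle (k 0)) (hle (k 1)) (hpos (k 1)) (by norm_num)
  split_ifs with h
  · have h1 : ((N : ℝ) ^ 2 - ((k 0 : ℝ) ^ 2 + (k 1 : ℝ) ^ 2)) / (N : ℝ) ^ 2 ≤ 1 := by
      rw [div_le_one (by positivity)]
      nlinarith [sq_nonneg (k 0 : ℝ), sq_nonneg (k 1 : ℝ)]
    calc _ ≤ 4 * (cosTransform hannCorr (2 * Real.pi * (√2 / N * k 0))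
          * cosTransform hannCorr (2 * Real.pi * (√2 / N * k 1))) * 1 := by gcongr
      _ ≤ 1 := by linarith
  · rw [mem_lowPass, EuclideanSpace.norm_eq, Real.sqrt_le_left hN'.le, Fin.sum_univ_two] at h
    simp only [Real.norm_eq_abs, sq_abs] at h
    exact mul_nonpos_of_nonneg_of_nonpos (by positivity)
      (div_nonpos_of_nonpos_of_nonneg (by linarith) (by positivity))

theorem normSq_sum_mul_mFourier {ι : Type*} (Z : Finset ι) (a : ι → ℂ)
    (p : ι → UnitAddTorus (Fin 2)) (k : Fin 2 → ℤ) :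
    ((‖∑ s ∈ Z, a s * UnitAddTorus.mFourier (-k) (p s)‖ ^ 2 : ℝ) : ℂ)
      = ∑ s ∈ Z, ∑ t ∈ Z, a s * starRingEnd ℂ (a t) * UnitAddTorus.mFourier k (p t - p s) := by
  rw [← Complex.normSq_eq_norm_sq, ← Complex.mul_conj, map_sum, Finset.sum_mul_sum]
  refine Finset.sum_congr rfl fun s _ => Finset.sum_congr rfl fun t _ => ?_
  have h : UnitAddTorus.mFourier k (p t - p s)
      = UnitAddTorus.mFourier k (p t) * UnitAddTorus.mFourier (-k) (p s) := by
    simp only [UnitAddTorus.mFourier, ContinuousMap.coe_mk, ← Finset.prod_mul_distrib]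
    refine Finset.prod_congr rfl fun i _ => ?_
    simp only [fourier_apply, Pi.sub_apply, Pi.neg_apply, sub_eq_add_neg, smul_add,
      smul_neg, AddCircle.toCircle_add, Circle.coe_mul, neg_smul]
  rw [h, map_mul, UnitAddTorus.mFourier_neg (x := p t), Complex.conj_conj]
  ring

/-- Inserting the Fourier series of the kernel turns the form into a sum of coefficients times
squared moments, which is compared termwise with the indicator. -/
theorem kernelForm_le_sum_lowPass {N : ℕ} (hN : 3 ≤ N) {ι : Type*} (Z : Finset ι) (a : ι → ℂ)
    (p : ι → UnitAddTorus (Fin 2)) :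
    (N : ℝ) ^ 2 * ∑ s ∈ Z, ∑ t ∈ Z,
        (a s * starRingEnd ℂ (a t)).re * torusKernel (√2 / N) (p t - p s)
      ≤ ∑ k ∈ lowPass 2 N, ‖∑ s ∈ Z, a s * UnitAddTorus.mFourier (-k) (p s)‖ ^ 2 := by
  have hN' : (3 : ℝ) ≤ N := by exact_mod_cast hN
  have hL : 0 < √2 / (N : ℝ) := by positivity
  have hL2 : √2 / (N : ℝ) ≤ 1 / 2 := by
    rw [div_le_iff₀ (by positivity), Real.sqrt_le_left (by positivity)]
    nlinarith
  set m : (Fin 2 → ℤ) → ℝ := fun k =>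
    ‖∑ s ∈ Z, a s * UnitAddTorus.mFourier (-k) (p s)‖ ^ 2 with hm
  have h1 : HasSum (fun k => ((torusKernelCoeff (√2 / N) k * m k : ℝ) : ℂ))
      (∑ s ∈ Z, ∑ t ∈ Z, a s * starRingEnd ℂ (a t) * torusKernel (√2 / N) (p t - p s)) := by
    have h := hasSum_sum (s := Z) fun s _ => hasSum_sum (s := Z) fun t _ =>
      (hasSum_torusKernel hL hL2 (p t - p s)).mul_left (a s * starRingEnd ℂ (a t))
    refine h.congr_fun fun k => ?_
    rw [Complex.ofReal_mul, hm, normSq_sum_mul_mFourier, Finset.mul_sum]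
    refine Finset.sum_congr rfl fun s _ => ?_
    rw [Finset.mul_sum]
    exact Finset.sum_congr rfl fun t _ => by ring
  have h2 := (Complex.reCLM.hasSum h1).mul_left ((N : ℝ) ^ 2)
  have h3 : HasSum (fun k => if k ∈ lowPass 2 N then m k else 0) (∑ k ∈ lowPass 2 N, m k) := by
    rw [← Finset.sum_congr rfl fun k hk => if_pos hk]
    exact hasSum_sum_of_ne_finset_zero fun k hk => if_neg hk
  refine le_trans (le_of_eq ?_) (hasSum_le (fun k => ?_) h2 h3)
  · simp
  · have hk := sq_mul_torusKernelCoeff_le (by omega : 0 < N) k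
    have hmk : 0 ≤ m k := by positivity
    simp only [Complex.reCLM_apply, Complex.ofReal_re]
    rw [← mul_assoc]
    refine (mul_le_mul_of_nonneg_right hk hmk).trans (le_of_eq ?_)
    split_ifs <;> simp

/-! ### Quadratic forms on separated node sets -/

section SeparatedNodes

variable {T : Type*} [SeminormedAddCommGroup T] {L : ℝ} {Ψ : T → ℝ} {Y : Finset T}

theorem far_or_unique_near (hY : (Y : Set T).Pairwise fun s t => 2 * L ≤ ‖s - t‖) (x : T) :
    (∀ t ∈ Y, L ≤ ‖x - t‖) ∨
      ∃ t₀ ∈ Y, ‖x - t₀‖ < L ∧ ∀ t ∈ Y, t ≠ t₀ → L ≤ ‖x - t‖ := by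
  by_cases h : ∀ t ∈ Y, L ≤ ‖x - t‖
  · exact Or.inl h
  push Not at h
  obtain ⟨t₀, h0, h1⟩ := h
  refine Or.inr ⟨t₀, h0, h1, fun t ht hne => ?_⟩
  have h2 := hY ht h0 hne
  have h3 := norm_sub_le (x - t₀) (x - t)
  rw [sub_sub_sub_cancel_left] at h3
  linarith

theorem sum_kernel_le (hY : (Y : Set T).Pairwise fun s t => 2 * L ≤ ‖s - t‖)
    (hsupp : ∀ x, L ≤ ‖x‖ → Ψ x = 0) (x : T) {B : ℝ} (hB : 0 ≤ B)
    (h : ∀ t ∈ Y, Ψ (x - t) ≤ B) : ∑ t ∈ Y, Ψ (x - t) ≤ B := by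
  rcases far_or_unique_near hY x with h1 | ⟨t₀, h0, -, h1⟩
  · rw [Finset.sum_eq_zero fun t ht => hsupp _ (h1 t ht)]
    exact hB
  · rw [Finset.sum_eq_single_of_mem t₀ h0 fun t ht hne => hsupp _ (h1 t ht hne)]
    exact h t₀ h0

theorem sum_sum_kernel_of_separated (hL : 0 < L)
    (hY : (Y : Set T).Pairwise fun s t => 2 * L ≤ ‖s - t‖)
    (hsupp : ∀ x, L ≤ ‖x‖ → Ψ x = 0) (c : T → ℂ) :
    ∑ s ∈ Y, ∑ t ∈ Y, (c s * starRingEnd ℂ (c t)).re * Ψ (t - s) = Ψ 0 * ∑ s ∈ Y, ‖c s‖ ^ 2 := by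
  rw [Finset.mul_sum]
  refine Finset.sum_congr rfl fun s hs => ?_
  rw [Finset.sum_eq_single_of_mem s hs fun t ht hne => ?_]
  · rw [Complex.mul_conj, Complex.ofReal_re, Complex.normSq_eq_norm_sq, sub_self, mul_comm]
  · rw [hsupp _ (by linarith [hY ht hs hne]), mul_zero]

/-- The quadratic form of a kernel at the difference of two measures with separated nodes. -/
noncomputable def pairForm (Ψ : T → ℝ) (Y₁ Y₂ : Finset T) (c₁ c₂ : T → ℂ) : ℝ :=
  3 / 4 * ∑ s ∈ Y₁, ‖c₁ s‖ ^ 2 + 3 / 4 * ∑ t ∈ Y₂, ‖c₂ t‖ ^ 2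
    - 2 * ∑ s ∈ Y₁, ∑ t ∈ Y₂, (c₁ s * starRingEnd ℂ (c₂ t)).re * Ψ (s - t)

variable {Y₁ Y₂ : Finset T} {c₁ c₂ : T → ℂ}

theorem re_mul_conj_comm (a b : ℂ) : (a * starRingEnd ℂ b).re = (b * starRingEnd ℂ a).re := by
  simp [Complex.mul_re]; ring

theorem pairForm_comm (heven : ∀ x, Ψ (-x) = Ψ x) :
    pairForm Ψ Y₁ Y₂ c₁ c₂ = pairForm Ψ Y₂ Y₁ c₂ c₁ := by
  rw [pairForm, pairForm, Finset.sum_comm, add_comm (3 / 4 * _)]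
  congr 2
  refine Finset.sum_congr rfl fun t _ => Finset.sum_congr rfl fun s _ => ?_
  rw [re_mul_conj_comm, ← heven, neg_sub]

/-- The difference of the measures is indexed by a disjoint sum, so a point that is a node of both
needs no merging. Separation kills the off-diagonal terms within each measure. -/
theorem sum_disjSum_kernel (hL : 0 < L) (heven : ∀ x, Ψ (-x) = Ψ x) (h0 : Ψ 0 = 3 / 4)
    (hsupp : ∀ x, L ≤ ‖x‖ → Ψ x = 0)
    (hY₁ : (Y₁ : Set T).Pairwise fun s t => 2 * L ≤ ‖s - t‖)
    (hY₂ : (Y₂ : Set T).Pairwise fun s t => 2 * L ≤ ‖s - t‖) :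
    ∑ s ∈ Y₁.disjSum Y₂, ∑ t ∈ Y₁.disjSum Y₂,
      (Sum.elim c₁ (fun t => -c₂ t) s * starRingEnd ℂ (Sum.elim c₁ (fun t => -c₂ t) t)).re
        * Ψ (Sum.elim id id t - Sum.elim id id s) = pairForm Ψ Y₁ Y₂ c₁ c₂ := by
  have h1 := sum_sum_kernel_of_separated hL hY₁ hsupp c₁
  have h2 := sum_sum_kernel_of_separated hL hY₂ hsupp c₂
  have h3 : ∑ s ∈ Y₁, ∑ t ∈ Y₂, (c₁ s * starRingEnd ℂ (c₂ t)).re * Ψ (t - s)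
      = ∑ s ∈ Y₁, ∑ t ∈ Y₂, (c₁ s * starRingEnd ℂ (c₂ t)).re * Ψ (s - t) :=
    Finset.sum_congr rfl fun s _ => Finset.sum_congr rfl fun t _ => by rw [← heven, neg_sub]
  have h4 : ∑ t ∈ Y₂, ∑ s ∈ Y₁, (c₂ t * starRingEnd ℂ (c₁ s)).re * Ψ (s - t)
      = ∑ s ∈ Y₁, ∑ t ∈ Y₂, (c₁ s * starRingEnd ℂ (c₂ t)).re * Ψ (s - t) := by
    rw [Finset.sum_comm]
    exact Finset.sum_congr rfl fun s _ => Finset.sum_congr rfl fun t _ => by rw [re_mul_conj_comm]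
  simp only [Finset.sum_disjSum, Sum.elim_inl, Sum.elim_inr, Finset.sum_add_distrib, map_neg,
    neg_mul, mul_neg, Complex.neg_re, Finset.sum_neg_distrib, id_eq]
  rw [h1, h2, h3, h4, h0, pairForm]
  ring

/-- Apply `2 Re (a b̄) ≤ |a|² + |b|²` to each cross term, with weight `Ψ ≥ 0`. -/
theorem weighted_sum_le_pairForm (hnn : ∀ x, 0 ≤ Ψ x) :
    ∑ s ∈ Y₁, (3 / 4 - ∑ t ∈ Y₂, Ψ (s - t)) * ‖c₁ s‖ ^ 2
      + ∑ t ∈ Y₂, (3 / 4 - ∑ s ∈ Y₁, Ψ (s - t)) * ‖c₂ t‖ ^ 2 ≤ pairForm Ψ Y₁ Y₂ c₁ c₂ := by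
  have hkey : ∑ s ∈ Y₁, ∑ t ∈ Y₂, 2 * ((c₁ s * starRingEnd ℂ (c₂ t)).re * Ψ (s - t))
      ≤ ∑ s ∈ Y₁, ∑ t ∈ Y₂, (Ψ (s - t) * ‖c₁ s‖ ^ 2 + Ψ (s - t) * ‖c₂ t‖ ^ 2) := by
    refine Finset.sum_le_sum fun s _ => Finset.sum_le_sum fun t _ => ?_
    have h1 : (c₁ s * starRingEnd ℂ (c₂ t)).re ≤ ‖c₁ s‖ * ‖c₂ t‖ := by
      simpa using Complex.re_le_norm (c₁ s * starRingEnd ℂ (c₂ t))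
    nlinarith [hnn (s - t), mul_nonneg (hnn (s - t)) (sq_nonneg (‖c₁ s‖ - ‖c₂ t‖)),
      mul_le_mul_of_nonneg_right h1 (hnn (s - t))]
  simp only [Finset.sum_add_distrib, ← Finset.mul_sum] at hkey
  rw [Finset.sum_comm (f := fun s t => Ψ (s - t) * ‖c₂ t‖ ^ 2)] at hkey
  simp only [← Finset.sum_mul] at hkey
  simp only [pairForm, sub_mul, Finset.sum_sub_distrib, ← Finset.mul_sum]
  linarith

theorem exists_near_of_pairForm_lt (heven : ∀ x, Ψ (-x) = Ψ x) (hnn : ∀ x, 0 ≤ Ψ x)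
    (hmax : ∀ x, Ψ x ≤ 3 / 4) (hsupp : ∀ x, L ≤ ‖x‖ → Ψ x = 0)
    (hquarter : ∀ x, L / 2 ≤ ‖x‖ → Ψ x ≤ 1 / 4)
    (hY₁ : (Y₁ : Set T).Pairwise fun s t => 2 * L ≤ ‖s - t‖)
    (hY₂ : (Y₂ : Set T).Pairwise fun s t => 2 * L ≤ ‖s - t‖) {cmin : ℝ} (hcmin : 0 ≤ cmin)
    (hc₁ : ∀ t ∈ Y₁, cmin ≤ ‖c₁ t‖) (hc₂ : ∀ t ∈ Y₂, cmin ≤ ‖c₂ t‖)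
    (hlt : pairForm Ψ Y₁ Y₂ c₁ c₂ < 3 / 4 * cmin ^ 2) :
    ∀ s ∈ Y₁, ∃ t ∈ Y₂, ‖s - t‖ ≤ L / 2 := by
  intro s hs
  by_contra! hfar
  have hr1 : ∀ x, ∑ t ∈ Y₂, Ψ (x - t) ≤ 3 / 4 := fun x =>
    sum_kernel_le hY₂ hsupp x (by norm_num) fun t _ => hmax _
  have hflip : ∀ t, ∑ s ∈ Y₁, Ψ (s - t) = ∑ s ∈ Y₁, Ψ (t - s) := fun t =>
    Finset.sum_congr rfl fun s _ => by rw [← heven, neg_sub]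
  have hr2 : ∀ x, ∑ s ∈ Y₁, Ψ (s - x) ≤ 3 / 4 := fun x => by
    rw [hflip]
    exact sum_kernel_le hY₁ hsupp x (by norm_num) fun t _ => hmax _
  have hw := weighted_sum_le_pairForm (Y₁ := Y₁) (Y₂ := Y₂) (c₁ := c₁) (c₂ := c₂) hnn
  have hn1 : ∀ x ∈ Y₁, 0 ≤ (3 / 4 - ∑ t ∈ Y₂, Ψ (x - t)) * ‖c₁ x‖ ^ 2 := fun x _ =>
    mul_nonneg (sub_nonneg.2 (hr1 x)) (sq_nonneg _)
  have hn2 : ∀ x ∈ Y₂, 0 ≤ (3 / 4 - ∑ s ∈ Y₁, Ψ (s - x)) * ‖c₂ x‖ ^ 2 := fun x _ =>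
    mul_nonneg (sub_nonneg.2 (hr2 x)) (sq_nonneg _)
  have hs1 := Finset.single_le_sum hn1 hs
  have hsq : cmin ^ 2 ≤ ‖c₁ s‖ ^ 2 := pow_le_pow_left₀ hcmin (hc₁ s hs) 2
  -- If no node of `Y₂` lies within `L`, the term of `s` alone is at least `3/4 * cmin ^ 2`.
  -- Otherwise the only such `t` has `Ψ (s - t) ≤ 1/4`, and the terms of `s` and `t` are each at
  -- least `1/2 * cmin ^ 2`.
  rcases far_or_unique_near hY₂ s with h | ⟨t, ht, htL, htu⟩
  · have h2 := Finset.sum_nonneg hn2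
    rw [Finset.sum_eq_zero fun t ht => hsupp _ (h t ht)] at hs1
    linarith
  · have hs2 := Finset.single_le_sum hn2 ht
    have hsq2 : cmin ^ 2 ≤ ‖c₂ t‖ ^ 2 := pow_le_pow_left₀ hcmin (hc₂ t ht) 2
    have hst := hquarter _ (hfar t ht).le
    have e1 : ∑ t ∈ Y₂, Ψ (s - t) ≤ 1 / 4 := by
      rwa [Finset.sum_eq_single_of_mem t ht fun u hu hne => hsupp _ (htu u hu hne)]
    have e2 : ∑ s ∈ Y₁, Ψ (s - t) ≤ 1 / 4 := by
      rwa [Finset.sum_eq_single_of_mem s hs fun u hu hne => hsupp _ ?_]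
      have h2 := hY₁ hu hs hne
      have h3 := norm_sub_le (u - t) (s - t)
      rw [sub_sub_sub_cancel_right] at h3
      linarith
    have e3 : 1 / 2 * cmin ^ 2 ≤ (3 / 4 - ∑ t ∈ Y₂, Ψ (s - t)) * ‖c₁ s‖ ^ 2 := by
      exact mul_le_mul (by linarith) (by assumption) (sq_nonneg _) (by linarith)
    have e4 : 1 / 2 * cmin ^ 2 ≤ (3 / 4 - ∑ s ∈ Y₁, Ψ (s - t)) * ‖c₂ t‖ ^ 2 := by
      exact mul_le_mul (by linarith) (by assumption) (sq_nonneg _) (by linarith)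
    nlinarith [sq_nonneg cmin]

theorem matched_sum_le_pairForm (hL : 0 < L) (hsupp : ∀ x, L ≤ ‖x‖ → Ψ x = 0)
    (hlow : ∀ x, ‖x‖ ≤ L / 2 → 1 / 16 ≤ Ψ x)
    (hquad : ∀ x, ‖x‖ ≤ L / 2 → Ψ x + 5 / 4 * (‖x‖ / L) ^ 2 ≤ 3 / 4)
    (hY₁ : (Y₁ : Set T).Pairwise fun s t => 2 * L ≤ ‖s - t‖)
    (hY₂ : (Y₂ : Set T).Pairwise fun s t => 2 * L ≤ ‖s - t‖) {cmin : ℝ} (hcmin : 0 ≤ cmin)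
    (hc₁ : ∀ t ∈ Y₁, cmin ≤ ‖c₁ t‖) (hc₂ : ∀ t ∈ Y₂, cmin ≤ ‖c₂ t‖) {η : T → T}
    (hη : ∀ s ∈ Y₁, η s ∈ Y₂ ∧ ‖s - η s‖ ≤ L / 2)
    (hsurj : ∀ t ∈ Y₂, ∃ s ∈ Y₁, ‖s - t‖ ≤ L / 2) :
    5 / 2 * cmin ^ 2 / L ^ 2 * ∑ s ∈ Y₁, ‖s - η s‖ ^ 2
      + 1 / 16 * ∑ s ∈ Y₁, ‖c₁ s - c₂ (η s)‖ ^ 2 ≤ pairForm Ψ Y₁ Y₂ c₁ c₂ := by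
  have huniq : ∀ s ∈ Y₁, ∀ t ∈ Y₂, t ≠ η s → L ≤ ‖s - t‖ := by
    intro s hs t ht hne
    have h2 := hY₂ ht (hη s hs).1 hne
    have h3 := norm_sub_le (s - η s) (s - t)
    rw [sub_sub_sub_cancel_left] at h3
    linarith [(hη s hs).2]
  -- The matching is a bijection: injective by separation of `Y₁`, surjective by `hsurj` and
  -- uniqueness.
  have hsum : ∑ t ∈ Y₂, ‖c₂ t‖ ^ 2 = ∑ s ∈ Y₁, ‖c₂ (η s)‖ ^ 2 := by
    refine (Finset.sum_bij (fun s _ => η s) (fun s hs => (hη s hs).1) ?_ ?_ fun _ _ => rfl).symm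
    · intro s hs s' hs' he
      by_contra hne
      have h2 := hY₁ hs hs' hne
      have h3 := norm_sub_le (s - η s) (s' - η s)
      rw [sub_sub_sub_cancel_right] at h3
      have h4 := (hη s' hs').2
      rw [← he] at h4
      linarith [(hη s hs).2]
    · intro t ht
      obtain ⟨s, hs, hst⟩ := hsurj t ht
      refine ⟨s, hs, ?_⟩
      by_contra hne
      linarith [huniq s hs t ht (Ne.symm hne)]
  have hcross : ∑ s ∈ Y₁, ∑ t ∈ Y₂, (c₁ s * starRingEnd ℂ (c₂ t)).re * Ψ (s - t)
      = ∑ s ∈ Y₁, (c₁ s * starRingEnd ℂ (c₂ (η s))).re * Ψ (s - η s) :=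
    Finset.sum_congr rfl fun s hs => Finset.sum_eq_single_of_mem _ (hη s hs).1 fun t ht hne => by
      rw [hsupp _ (huniq s hs t ht hne), mul_zero]
  rw [pairForm, hsum, hcross]
  simp only [Finset.mul_sum]
  rw [← Finset.sum_add_distrib, ← Finset.sum_add_distrib, ← Finset.sum_sub_distrib]
  refine Finset.sum_le_sum fun s hs => ?_
  obtain ⟨h1, h2⟩ := hη s hs
  have hq := hquad _ h2
  have hl := hlow _ h2
  have hsq1 : cmin ^ 2 ≤ ‖c₁ s‖ ^ 2 := pow_le_pow_left₀ hcmin (hc₁ s hs) 2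
  have hsq2 : cmin ^ 2 ≤ ‖c₂ (η s)‖ ^ 2 := pow_le_pow_left₀ hcmin (hc₂ _ h1) 2
  have hns : ‖c₁ s - c₂ (η s)‖ ^ 2
      = ‖c₁ s‖ ^ 2 + ‖c₂ (η s)‖ ^ 2 - 2 * (c₁ s * starRingEnd ℂ (c₂ (η s))).re := by
    simp only [← Complex.normSq_eq_norm_sq, Complex.normSq_sub]
  have e1 : 5 / 2 * cmin ^ 2 / L ^ 2 * ‖s - η s‖ ^ 2
      = 5 / 4 * (‖s - η s‖ / L) ^ 2 * (2 * cmin ^ 2) := by ring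
  have e2 : 5 / 4 * (‖s - η s‖ / L) ^ 2 * (2 * cmin ^ 2)
      ≤ (3 / 4 - Ψ (s - η s)) * (‖c₁ s‖ ^ 2 + ‖c₂ (η s)‖ ^ 2) := by
    have : 0 ≤ 5 / 4 * (‖s - η s‖ / L) ^ 2 := by positivity
    refine mul_le_mul (by linarith) (by linarith) (by positivity) (by linarith)
  have e3 := mul_le_mul_of_nonneg_right hl (sq_nonneg ‖c₁ s - c₂ (η s)‖)
  rw [e1]
  nlinarith

end SeparatedNodes

/-! ### Direct estimates for one-point measures -/

/-- The chord has length `2 sin (πd)` for the circle distance `d ≤ 1/2`, and Jordan's inequality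
gives `sin (πd) ≥ 2d`. -/
theorem four_mul_norm_sub_le (a b : UnitAddCircle) :
    4 * ‖a - b‖ ≤ ‖fourier 1 a - fourier 1 b‖ := by
  obtain ⟨y, hy⟩ := QuotientAddGroup.mk_surjective (a - b)
  have hab : a = b + (y : UnitAddCircle) := by rw [← sub_eq_iff_eq_add']; exact hy.symm
  have h1 : ‖fourier 1 a - fourier 1 b‖ = ‖Complex.exp (Complex.I * (2 * Real.pi * y : ℝ)) - 1‖ := by
    have e : (fourier 1 a : ℂ) = fourier 1 b * fourier 1 (y : UnitAddCircle) := by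
      simp only [hab, fourier_one, AddCircle.toCircle_add, Circle.coe_mul]
    rw [e, ← mul_sub_one, norm_mul, fourier_coe_apply]
    have hb : ‖(fourier 1 b : ℂ)‖ = 1 := by
      rw [fourier_apply]
      exact Circle.norm_coe _
    rw [hb, one_mul]
    congr 3
    push_cast
    ring
  have h2 : |Real.sin (2 * Real.pi * y / 2)| = |Real.sin (Real.pi * (y - round y))| := by
    have h := Real.sin_sub_int_mul_pi (Real.pi * y) (round y)
    rw [show Real.pi * (y - round y) = Real.pi * y - round y * Real.pi by ring, h, abs_mul,
      abs_zpow, abs_neg, abs_one, one_zpow, one_mul]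
    congr 2
    ring
  have h3 : |Real.pi * (y - round y)| ≤ Real.pi / 2 := by
    rw [abs_mul, abs_of_pos Real.pi_pos]
    nlinarith [abs_sub_round y, Real.pi_pos]
  have h4 := Real.mul_abs_le_abs_sin h3
  rw [abs_mul, abs_of_pos Real.pi_pos, ← mul_assoc, div_mul_cancel₀ _ Real.pi_ne_zero] at h4
  rw [h1, Complex.norm_exp_I_mul_ofReal_sub_one, Real.norm_eq_abs, abs_mul, h2, abs_two]
  have h5 : ‖a - b‖ = |y - round y| := by rw [← hy]; exact UnitAddCircle.norm_eq
  rw [h5]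
  linarith

theorem mFourier_single_apply (i : Fin 2) (n : ℤ) (x : UnitAddTorus (Fin 2)) :
    UnitAddTorus.mFourier (Pi.single i n) x = fourier n (x i) := by
  rw [UnitAddTorus.mFourier, ContinuousMap.coe_mk]
  refine (Finset.prod_eq_single_of_mem i (Finset.mem_univ i) fun j _ hj => ?_).trans (by simp)
  rw [Pi.single_eq_of_ne hj, fourier_zero]

/-- The frequencies `±eᵢ`, for a coordinate `i` realizing the norm, contribute at least `4² ‖s -
t‖²` each. -/
theorem sq_norm_sub_le_sum_lowPass {N : ℕ} (hN : 0 < N) (s t : UnitAddTorus (Fin 2)) :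
    32 * ‖s - t‖ ^ 2 ≤ ∑ k ∈ lowPass 2 N,
      ‖UnitAddTorus.mFourier (-k) s - UnitAddTorus.mFourier (-k) t‖ ^ 2 := by
  obtain ⟨i, hi⟩ := exists_norm_eq_norm_apply (s - t)
  have hmem : ∀ n : ℤ, n ^ 2 = 1 → (Pi.single i n : Fin 2 → ℤ) ∈ lowPass 2 N := by
    intro n hn
    have hN' : (1 : ℝ) ≤ N := by exact_mod_cast hN
    have hn' : (n : ℝ) ^ 2 = 1 := by exact_mod_cast hn
    rw [mem_lowPass, EuclideanSpace.norm_eq, Real.sqrt_le_left (by positivity), Fin.sum_univ_two]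
    fin_cases i <;> simp [hn', hN']
  have h4 := four_mul_norm_sub_le (s i) (t i)
  have hle : 16 * ‖s - t‖ ^ 2 ≤ ‖(fourier 1 (s i) : ℂ) - fourier 1 (t i)‖ ^ 2 := by
    rw [hi, Pi.sub_apply, show (16 : ℝ) = 4 ^ 2 by norm_num, ← mul_pow]
    gcongr
  have hconj : ‖(fourier (-1) (s i) : ℂ) - fourier (-1) (t i)‖
      = ‖(fourier 1 (s i) : ℂ) - fourier 1 (t i)‖ := by
    rw [fourier_neg, fourier_neg, ← map_sub, Complex.norm_conj]
  have hsub : ({Pi.single i 1, Pi.single i (-1)} : Finset (Fin 2 → ℤ)) ⊆ lowPass 2 N := by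
    intro k hk
    rw [Finset.mem_insert, Finset.mem_singleton] at hk
    rcases hk with rfl | rfl <;> exact hmem _ (by norm_num)
  refine le_trans ?_ (Finset.sum_le_sum_of_subset_of_nonneg hsub fun _ _ _ => sq_nonneg _)
  rw [Finset.sum_pair fun h => by simpa using congrFun h i, ← Pi.single_neg, ← Pi.single_neg,
    neg_neg]
  simp only [mFourier_single_apply]
  rw [hconj]
  linarith

theorem norm_unitAddTorus_le (x : UnitAddTorus (Fin 2)) : ‖x‖ ≤ 1 / 2 :=
  (pi_norm_le_iff_of_nonneg (by norm_num)).2 fun i => by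
    simpa using AddCircle.norm_le_half_period 1 one_ne_zero (x := x i)

theorem exists_eq_singleton_of_separated {Y : Finset (UnitAddTorus (Fin 2))}
    {c : UnitAddTorus (Fin 2) → ℂ} {q : ℝ} (hq : 1 / 2 < q)
    (hY : (Y : Set (UnitAddTorus (Fin 2))).Pairwise fun s t => q ≤ ‖s - t‖)
    (hsum : ∑ t ∈ Y, c t = 1) : ∃ s, Y = {s} ∧ c s = 1 := by
  obtain ⟨s, hs⟩ : Y.Nonempty := by
    rw [Finset.nonempty_iff_ne_empty]
    rintro rfl
    simp at hsum
  have h : Y = {s} := Finset.eq_singleton_iff_unique_mem.2 ⟨hs, fun t ht => by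
    by_contra hne
    linarith [hY ht hs hne, norm_unitAddTorus_le (t - s)]⟩
  refine ⟨s, h, ?_⟩
  rw [h, Finset.sum_singleton] at hsum
  exact hsum

/-! ### Stability of nodes and weights -/

section Stability

variable {N : ℕ} {cmin : ℝ} {Y₁ Y₂ : Finset (UnitAddTorus (Fin 2))}
  {c₁ c₂ : UnitAddTorus (Fin 2) → ℂ}

/-- The squared `ℓ²`-distance of the low frequency moments of two atomic measures. -/
noncomputable def momentDistSq (N : ℕ) (Y₁ Y₂ : Finset (UnitAddTorus (Fin 2)))
    (c₁ c₂ : UnitAddTorus (Fin 2) → ℂ) : ℝ :=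
  ∑ k ∈ lowPass 2 N, ‖∑ t ∈ Y₁, c₁ t * UnitAddTorus.mFourier (-k) t
    - ∑ t ∈ Y₂, c₂ t * UnitAddTorus.mFourier (-k) t‖ ^ 2

theorem pairForm_le_momentDistSq (hN : 3 ≤ N)
    (hY₁ : (Y₁ : Set (UnitAddTorus (Fin 2))).Pairwise fun s t => 2 * (√2 / (N : ℝ)) ≤ ‖s - t‖)
    (hY₂ : (Y₂ : Set (UnitAddTorus (Fin 2))).Pairwise fun s t => 2 * (√2 / (N : ℝ)) ≤ ‖s - t‖) :
    (N : ℝ) ^ 2 * pairForm (torusKernel (√2 / N)) Y₁ Y₂ c₁ c₂ ≤ momentDistSq N Y₁ Y₂ c₁ c₂ := by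
  have hN' : (3 : ℝ) ≤ N := by exact_mod_cast hN
  have hL : 0 < √2 / (N : ℝ) := by positivity
  have h := kernelForm_le_sum_lowPass hN (Y₁.disjSum Y₂) (Sum.elim c₁ fun t => -c₂ t)
    (Sum.elim id id)
  rw [sum_disjSum_kernel hL (fun _ => torusKernel_neg) torusKernel_zero
    (fun _ => torusKernel_eq_zero hL) hY₁ hY₂] at h
  simpa [momentDistSq, Finset.sum_disjSum, sub_eq_add_neg] using h

/-- The conclusion of the stability estimate on the level of node sets and weights. -/
def IsStablyMatched (N : ℕ) (cmin : ℝ) (Y₁ Y₂ : Finset (UnitAddTorus (Fin 2)))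
    (c₁ c₂ : UnitAddTorus (Fin 2) → ℂ) : Prop :=
  (∀ s ∈ Y₁, ∃ t ∈ Y₂, ‖s - t‖ ≤ √2 / N / 2) ∧ (∀ t ∈ Y₂, ∃ s ∈ Y₁, ‖s - t‖ ≤ √2 / N / 2) ∧
    ∀ η : UnitAddTorus (Fin 2) → UnitAddTorus (Fin 2),
      (∀ s ∈ Y₁, η s ∈ Y₂ ∧ ‖s - η s‖ ≤ √2 / N / 2) →
      5 / 4 * (N : ℝ) ^ 4 * cmin ^ 2 * ∑ s ∈ Y₁, ‖s - η s‖ ^ 2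
        + 1 / 16 * (N : ℝ) ^ 2 * ∑ s ∈ Y₁, ‖c₁ s - c₂ (η s)‖ ^ 2 ≤ momentDistSq N Y₁ Y₂ c₁ c₂

theorem isStablyMatched_of_three_le (hN : 3 ≤ N) (hcmin : 0 < cmin)
    (hc₁ : ∀ t ∈ Y₁, cmin ≤ ‖c₁ t‖) (hc₂ : ∀ t ∈ Y₂, cmin ≤ ‖c₂ t‖)
    (hY₁ : (Y₁ : Set (UnitAddTorus (Fin 2))).Pairwise fun s t => 2 * (√2 / (N : ℝ)) ≤ ‖s - t‖)
    (hY₂ : (Y₂ : Set (UnitAddTorus (Fin 2))).Pairwise fun s t => 2 * (√2 / (N : ℝ)) ≤ ‖s - t‖)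
    (hsmall : momentDistSq N Y₁ Y₂ c₁ c₂ < 3 / 4 * (N : ℝ) ^ 2 * cmin ^ 2) :
    IsStablyMatched N cmin Y₁ Y₂ c₁ c₂ := by
  have hN' : (3 : ℝ) ≤ N := by exact_mod_cast hN
  have hL : 0 < √2 / (N : ℝ) := by positivity
  have hle := pairForm_le_momentDistSq (c₁ := c₁) (c₂ := c₂) hN hY₁ hY₂
  have hlt : pairForm (torusKernel (√2 / N)) Y₁ Y₂ c₁ c₂ < 3 / 4 * cmin ^ 2 := by
    refine lt_of_mul_lt_mul_left (hle.trans_lt (hsmall.trans_eq ?_)) (sq_nonneg (N : ℝ))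
    ring
  have hmax : ∀ x, torusKernel (√2 / N) x ≤ 3 / 4 := fun x => by
    rcases le_total ‖x‖ (√2 / N / 2) with h | h
    · have := torusKernel_add_le hL h
      have h2 : 0 ≤ 5 / 4 * (‖x‖ / (√2 / N)) ^ 2 := by positivity
      linarith
    · linarith [torusKernel_le_quarter hL h]
  have hlt' := hlt
  rw [pairForm_comm fun _ => torusKernel_neg] at hlt'
  have hs := exists_near_of_pairForm_lt (fun _ => torusKernel_neg) (fun _ => torusKernel_nonneg hL)
    hmax (fun _ => torusKernel_eq_zero hL) (fun _ => torusKernel_le_quarter hL) hY₂ hY₁ hcmin.le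
    hc₂ hc₁ hlt'
  have hsurj : ∀ t ∈ Y₂, ∃ s ∈ Y₁, ‖s - t‖ ≤ √2 / N / 2 := fun t ht => by
    obtain ⟨s, hs, h⟩ := hs t ht
    exact ⟨s, hs, by rwa [norm_sub_rev]⟩
  refine ⟨exists_near_of_pairForm_lt (fun _ => torusKernel_neg) (fun _ => torusKernel_nonneg hL)
    hmax (fun _ => torusKernel_eq_zero hL) (fun _ => torusKernel_le_quarter hL) hY₁ hY₂ hcmin.le
    hc₁ hc₂ hlt, hsurj, fun η hη => ?_⟩
  have h := matched_sum_le_pairForm hL (fun _ => torusKernel_eq_zero hL)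
    (fun _ => le_torusKernel hL) (fun _ => torusKernel_add_le hL) hY₁ hY₂ hcmin.le hc₁ hc₂ hη hsurj
  -- Since `L² = 2 / N²`, the factor `N² * (5/2) / L²` equals `5/4 * N⁴`.
  refine le_trans (le_of_eq ?_) ((mul_le_mul_of_nonneg_left h (sq_nonneg (N : ℝ))).trans hle)
  rw [div_pow, Real.sq_sqrt (by norm_num)]
  field_simp
  ring

/-- Separation above the diameter `1/2` of the torus forces unit point masses, so `cmin ≤ 1` and the
weights agree. The node term then needs only `5/4 * 2⁴ = 20 ≤ 32`. -/
theorem isStablyMatched_of_le_two (hN : 0 < N) (hN2 : N ≤ 2) (hcmin : 0 < cmin)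
    (hc₁ : ∀ t ∈ Y₁, cmin ≤ ‖c₁ t‖) (hs₁ : ∑ t ∈ Y₁, c₁ t = 1) (hs₂ : ∑ t ∈ Y₂, c₂ t = 1)
    (hY₁ : (Y₁ : Set (UnitAddTorus (Fin 2))).Pairwise fun s t => 2 * (√2 / (N : ℝ)) ≤ ‖s - t‖)
    (hY₂ : (Y₂ : Set (UnitAddTorus (Fin 2))).Pairwise fun s t => 2 * (√2 / (N : ℝ)) ≤ ‖s - t‖)
    (hsmall : momentDistSq N Y₁ Y₂ c₁ c₂ < 3 / 4 * (N : ℝ) ^ 2 * cmin ^ 2) :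
    IsStablyMatched N cmin Y₁ Y₂ c₁ c₂ := by
  have hN1 : (1 : ℝ) ≤ N := by exact_mod_cast hN
  have hN2' : (N : ℝ) ≤ 2 := by exact_mod_cast hN2
  have hq : 1 / 2 < 2 * (√2 / (N : ℝ)) := by
    rw [← mul_div_assoc, lt_div_iff₀ (by positivity)]
    linarith [Real.one_lt_sqrt_two]
  obtain ⟨s, rfl, hs⟩ := exists_eq_singleton_of_separated hq hY₁ hs₁
  obtain ⟨t, rfl, ht⟩ := exists_eq_singleton_of_separated hq hY₂ hs₂
  have hc : cmin ≤ 1 := by simpa [hs] using hc₁ s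
  have hc2 : cmin ^ 2 ≤ 1 := pow_le_one₀ hcmin.le hc
  have hN4 : (N : ℝ) ^ 2 ≤ 4 := by nlinarith
  have hdist : 32 * ‖s - t‖ ^ 2 ≤ momentDistSq N {s} {t} c₁ c₂ := by
    simpa [momentDistSq, hs, ht] using sq_norm_sub_le_sum_lowPass hN s t
  have hnear : ‖s - t‖ ≤ √2 / N / 2 := by
    refine le_of_sq_le_sq ?_ (by positivity)
    rw [div_pow, div_pow, Real.sq_sqrt (by norm_num), div_div, le_div_iff₀ (by positivity)]
    -- The moment sum is below `3`, and `3/32 ≤ 1/8 ≤ 1 / (2N²)`.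
    have h1 : ‖s - t‖ ^ 2 ≤ 3 / 32 := by
      have : 3 / 4 * (N : ℝ) ^ 2 * cmin ^ 2 ≤ 3 / 4 * 4 * 1 := by gcongr
      linarith
    calc ‖s - t‖ ^ 2 * ((N : ℝ) ^ 2 * 2 ^ 2) ≤ 3 / 32 * (4 * 2 ^ 2) := by gcongr
      _ ≤ 2 := by norm_num
  refine ⟨by simpa using hnear, by simpa using hnear, fun η hη => ?_⟩
  have hηs : η s = t := by simpa using (hη s (by simp)).1
  simp only [Finset.sum_singleton, hηs, hs, ht, sub_self, norm_zero]
  refine le_trans ?_ hdist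
  have : 5 / 4 * (N : ℝ) ^ 4 * cmin ^ 2 ≤ 5 / 4 * 2 ^ 4 * 1 := by gcongr
  nlinarith [sq_nonneg ‖s - t‖]

end Stability

theorem mainTheorem3 (N : ℕ) (hN : 0 < N) (cmin : ℝ) (hcmin : 0 < cmin)
    (μ₁ μ₂ : ComplexMeasure (UnitAddTorus (Fin 2)))
    (hμ₁ : μ₁ ∈ separatedMeasures 2 cmin (2 * (√2 / (N : ℝ))))
    (hμ₂ : μ₂ ∈ separatedMeasures 2 cmin (2 * (√2 / (N : ℝ))))
    (hsmall : ∑ k ∈ lowPass 2 N, ‖moment μ₁ k - moment μ₂ k‖ ^ 2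
      < 3 / 4 * (N : ℝ) ^ 2 * cmin ^ 2) :
    ∃ η : UnitAddTorus (Fin 2) → UnitAddTorus (Fin 2),
      (∀ t ∈ nodeSet μ₁,
        (η t ∈ nodeSet μ₂ ∧ ‖t - η t‖ ≤ 1 / (√2 * (N : ℝ))) ∧
        ∀ t' ∈ nodeSet μ₂, ‖t - t'‖ ≤ 1 / (√2 * (N : ℝ)) → t' = η t) ∧
      (∀ t' ∈ nodeSet μ₂, ∃! t, t ∈ nodeSet μ₁ ∧ ‖t - t'‖ ≤ 1 / (√2 * (N : ℝ))) ∧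
      5 / 4 * (N : ℝ) ^ 4 * cmin ^ 2 * ∑ᶠ t ∈ nodeSet μ₁, ‖t - η t‖ ^ 2
        + 1 / 16 * (N : ℝ) ^ 2 * ∑ᶠ t ∈ nodeSet μ₁, ‖weight μ₁ t - weight μ₂ (η t)‖ ^ 2
      ≤ ∑ k ∈ lowPass 2 N, ‖moment μ₁ k - moment μ₂ k‖ ^ 2 := by
  classical
  obtain ⟨Y₁, c₁, hc₁, hs₁, hY₁, rfl⟩ := hμ₁
  obtain ⟨Y₂, c₂, hc₂, hs₂, hY₂, rfl⟩ := hμ₂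
  have hne₁ : ∀ t ∈ Y₁, c₁ t ≠ 0 := fun t ht => norm_pos_iff.1 (hcmin.trans_le (hc₁ t ht))
  have hne₂ : ∀ t ∈ Y₂, c₂ t ≠ 0 := fun t ht => norm_pos_iff.1 (hcmin.trans_le (hc₂ t ht))
  have hmom : ∑ k ∈ lowPass 2 N, ‖moment (atomicMeasure Y₁ c₁) k
      - moment (atomicMeasure Y₂ c₂) k‖ ^ 2 = momentDistSq N Y₁ Y₂ c₁ c₂ := by
    simp only [moment_atomicMeasure, momentDistSq]
  have hN' : (0 : ℝ) < N := by exact_mod_cast hN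
  have hL : 0 < √2 / (N : ℝ) := by positivity
  have hhalf : 1 / (√2 * (N : ℝ)) = √2 / N / 2 := by
    have h2 : √2 ≠ 0 := by positivity
    have h3 : √2 * √2 = 2 := Real.mul_self_sqrt (by norm_num)
    field_simp
    linarith
  rw [hmom] at hsmall
  rw [hmom, nodeSet_atomicMeasure Y₁ c₁ hne₁, nodeSet_atomicMeasure Y₂ c₂ hne₂, hhalf]
  simp only [Finset.mem_coe]
  obtain ⟨hex, hsurj, hest⟩ : IsStablyMatched N cmin Y₁ Y₂ c₁ c₂ := by
    rcases le_or_gt N 2 with h | h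
    · exact isStablyMatched_of_le_two hN h hcmin hc₁ hs₁ hs₂ hY₁ hY₂ hsmall
    · exact isStablyMatched_of_three_le h hcmin hc₁ hc₂ hY₁ hY₂ hsmall
  choose! η hη using hex
  refine ⟨η, fun t ht => ⟨hη t ht, fun t' ht' h => ?_⟩, fun t' ht' => ?_, ?_⟩
  · by_contra hne
    have h2 := hY₂ ht' (hη t ht).1 hne
    have h3 := norm_sub_le (t - η t) (t - t')
    rw [sub_sub_sub_cancel_left] at h3
    linarith [(hη t ht).2]
  · obtain ⟨s, hs, hst⟩ := hsurj t' ht'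
    refine ⟨s, ⟨hs, hst⟩, fun u hu => ?_⟩
    by_contra hne
    have h2 := hY₁ hu.1 hs hne
    have h3 := norm_sub_le (u - t') (s - t')
    rw [sub_sub_sub_cancel_right] at h3
    linarith [hu.2]
  · have hw : ∑ᶠ t ∈ Y₁, ‖weight (atomicMeasure Y₁ c₁) t - weight (atomicMeasure Y₂ c₂) (η t)‖ ^ 2
        = ∑ t ∈ Y₁, ‖c₁ t - c₂ (η t)‖ ^ 2 := by
      rw [finsum_mem_finset_eq_sum]
      refine Finset.sum_congr rfl fun t ht => ?_
      rw [weight_atomicMeasure, weight_atomicMeasure, if_pos ht, if_pos (hη t ht).1]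
    rw [hw, finsum_mem_finset_eq_sum]
    exact hest η hη
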